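/- Consider the Kepler problem in $\mathbb{R}^4$: a unit mass point with position $q=(x,y,z,w)$ and momentum $p$ moves according to Hamilton's equations $\dot q=\partial H/\partial p$, $\dot p=-\partial H/\partial q$ of the Hamiltonian $$H(q,p)=\tfrac12\|p\|^2-\frac{k}{\|q\|},\qquad k>0,\quad q\neq 0 .$$ Let $r_1=\sqrt{x^2+y^2}$ and $r_2=\sqrt{z^2+w^2}$ be the polar radii of the projections of $q$ onto the principal planes $Oxy$ and $Ozw$, and let $R=\|q\|=\sqrt{r_1^2+r_2^2}$. Let $(q(t),p(t))$ be a solution on a nonempty open time interval $I=(a,b)$, $-\infty\le a<b\le\infty$, and suppose that it is collisional, i.e. $r_1(t)^2+r_2(t)^2\to 0$ as $t\in I$ tends to one of the end points of $I$. Then: 1. If the orbit is not contained in one of the principal planes (that is, neither $r_1\equiv 0$ on $I$ nor $r_2\equiv 0$ on $I$), it is a proportional motion: there is a constant $\lambda>0$ with $r_1(t)=\lambda r_2(t)$ for all $t\in I$. 2. In every case the polar angle of $(r_1,r_2)$ is constant: there is $\varphi_0\in[0,\pi/2]$ with $r_1(t)=R(t)\cos\varphi_0$ and $r_2(t)=R(t)\sin\varphi_0$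 for all $t\in I$. 3. The orbit is collinear: it lies on a line through the origin. More precisely, there is a constant unit vector $e\in\mathbb{R}^4$ with $q(t)=R(t)\,e$ for all $t\in I$, and $R$ satisfies the radial Kepler equation $\ddot R=-k/R^2$ on $I$. -/

import Mathlib

open Filter Topology

noncomputable section

namespace Kepler4

/-- The configuration space `ℝ⁴` with its Euclidean norm; the coordinates `0, 1, 2, 3` are
`x, y, z, w`. -/
abbrev R4 : Type := EuclideanSpace ℝ (Fin 4)

/-- The polar radius `r₁ = √(x² + y²)` of the projection onto the principal plane `Oxy`. -/
def r₁ (q : R4) : ℝ := √(q 0 ^ 2 + q 1 ^ 2)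

/-- The polar radius `r₂ = √(z² + w²)` of the projection onto the principal plane `Ozw`. -/
def r₂ (q : R4) : ℝ := √(q 2 ^ 2 + q 3 ^ 2)

/-- The Hamiltonian `H(q, p) = p² / 2 - k / ‖q‖` of a unit mass point, meant for `q ≠ 0`. -/
def hamiltonian (k : ℝ) (q p : R4) : ℝ := ‖p‖ ^ 2 / 2 - k / ‖q‖

/-- The open time interval with finite or infinite end points `a` and `b`. -/
def timeInterval (a b : EReal) : Set ℝ := {t | a < (t : EReal) ∧ (t : EReal) < b}

/-- `(q, p)` solves Hamilton's equations `q' = ∂H/∂p`, `p' = -∂H/∂q` of the Kepler problem on the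
nonempty open time interval from `a` to `b`, staying in the phase space `q ≠ 0`. -/
structure IsMotion (k : ℝ) (a b : EReal) (q p : ℝ → R4) : Prop where
  lt : a < b
  ne_zero : ∀ t ∈ timeInterval a b, q t ≠ 0
  deriv_q : ∀ t ∈ timeInterval a b,
    HasDerivAt q (gradient (fun v => hamiltonian k (q t) v) (p t)) t
  deriv_p : ∀ t ∈ timeInterval a b,
    HasDerivAt p (-gradient (fun u => hamiltonian k u (p t)) (q t)) t

/-- The orbit has a collision with the source at one of the (finite or infinite) ends of the time
interval: `r₁(t)² + r₂(t)² → 0` as `t` tends to that end from inside the interval. -/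
def IsCollisional (a b : EReal) (q : ℝ → R4) : Prop :=
  Tendsto (fun t => r₁ (q t) ^ 2 + r₂ (q t) ^ 2) (comap Real.toEReal (𝓝[<] b)) (𝓝 0) ∨
  Tendsto (fun t => r₁ (q t) ^ 2 + r₂ (q t) ^ 2) (comap Real.toEReal (𝓝[>] a)) (𝓝 0)

/-- Proportional motion: `r₁(t) = c r₂(t)` for some constant `c > 0` and all times `t`. -/
def IsProportional (a b : EReal) (q : ℝ → R4) : Prop :=
  ∃ c : ℝ, 0 < c ∧ ∀ t ∈ timeInterval a b, r₁ (q t) = c * r₂ (q t)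

/-- The motion stays in one of the two principal planes `Ozw` (`r₁ = 0`) or `Oxy` (`r₂ = 0`). -/
def InPrincipalPlane (a b : EReal) (q : ℝ → R4) : Prop :=
  (∀ t ∈ timeInterval a b, r₁ (q t) = 0) ∨ (∀ t ∈ timeInterval a b, r₂ (q t) = 0)

end Kepler4

end

/-!
The Kepler force is central, so the angular momentum `q ∧ p` is conserved. Conservation of energy
gives `‖q‖² ‖p‖² = 2 c ‖q‖² + 2 k ‖q‖` with a constant `c`; hence `‖q‖ ‖p‖`, which dominates the
angular momentum, tends to `0` at a collision, and the angular momentum vanishes identically. The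
direction `q / ‖q‖` has derivative `(q ∧ p) q / ‖q‖³`, so it is a constant vector `e`. Everything
else is read off from `q = ‖q‖ e`: both polar radii are `‖q‖` times those of `e`, and the
centrifugal term of the radial equation, which comes from the angular momentum, is absent.
-/

open scoped RealInnerProductSpace

namespace Kepler4

section Calculus

variable {E F : Type*} [NormedAddCommGroup E] [InnerProductSpace ℝ E]
  [NormedAddCommGroup F] [NormedSpace ℝ F]

lemma eq_of_hasDerivAt_zero {I : Set ℝ} (hI : IsOpen I) (hconn : IsPreconnected I) {f : ℝ → F}
    (hf : ∀ t ∈ I, HasDerivAt f 0 t) {s t : ℝ} (hs : s ∈ I) (ht : t ∈ I) : f s = f t :=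
  hI.is_const_of_deriv_eq_zero hconn
    (fun x hx => (hf x hx).differentiableAt.differentiableWithinAt)
    (fun x hx => (hf x hx).deriv) hs ht

lemma hasFDerivAt_norm {x : E} (hx : x ≠ 0) :
    HasFDerivAt (fun y : E => ‖y‖) (‖x‖⁻¹ • innerSL ℝ x) x := by
  have h := (hasStrictFDerivAt_norm_sq x).hasFDerivAt.sqrt (by simpa using hx)
  simp only [Real.sqrt_sq (norm_nonneg _)] at h
  refine h.congr_fderiv ?_
  rw [← Nat.cast_smul_eq_nsmul ℝ, smul_smul]
  congr 1
  simp [field]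

lemma hasDerivAt_norm {q : ℝ → E} {v : E} {t : ℝ} (hq : HasDerivAt q v t) (h0 : q t ≠ 0) :
    HasDerivAt (fun s => ‖q s‖) (⟪q t, v⟫ / ‖q t‖) t := by
  refine ((hasFDerivAt_norm h0).comp_hasDerivAt t hq).congr_deriv ?_
  simp [div_eq_inv_mul]

lemma hasDerivAt_norm_inv {q : ℝ → E} {v : E} {t : ℝ} (hq : HasDerivAt q v t) (h0 : q t ≠ 0) :
    HasDerivAt (fun s => ‖q s‖⁻¹) (-⟪q t, v⟫ / ‖q t‖ ^ 3) t := by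
  refine ((hasDerivAt_norm hq h0).fun_inv (norm_ne_zero_iff.2 h0)).congr_deriv ?_
  field_simp

end Calculus

section AngularMomentum

variable {E : Type*} [NormedAddCommGroup E] [InnerProductSpace ℝ E]

/-- The angular momentum `q ∧ p` of a unit mass point. In the absence of a cross product the
bivector is encoded as the skew-symmetric endomorphism `u ↦ ⟪q, u⟫ p - ⟪p, u⟫ q`. -/
def angularMomentum (q p u : E) : E := ⟪q, u⟫ • p - ⟪p, u⟫ • q

lemma norm_angularMomentum_le (q p u : E) :
    ‖angularMomentum q p u‖ ≤ 2 * ‖u‖ * (‖q‖ * ‖p‖) :=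
  calc ‖angularMomentum q p u‖ ≤ ‖⟪q, u⟫ • p‖ + ‖⟪p, u⟫ • q‖ := norm_sub_le _ _
    _ = ‖⟪q, u⟫‖ * ‖p‖ + ‖⟪p, u⟫‖ * ‖q‖ := by rw [norm_smul, norm_smul]
    _ ≤ ‖q‖ * ‖u‖ * ‖p‖ + ‖p‖ * ‖u‖ * ‖q‖ := by gcongr <;> exact norm_inner_le_norm _ _
    _ = 2 * ‖u‖ * (‖q‖ * ‖p‖) := by ring

lemma hasDerivAt_angularMomentum_of_central_force {q p : ℝ → E} {t c : ℝ}
    (hq : HasDerivAt q (p t) t) (hp : HasDerivAt p (c • q t) t) (u : E) :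
    HasDerivAt (fun s => angularMomentum (q s) (p s) u) 0 t := by
  have hqu := hq.inner ℝ (hasDerivAt_const t u)
  have hpu := hp.inner ℝ (hasDerivAt_const t u)
  refine ((hqu.fun_smul hp).fun_sub (hpu.fun_smul hq)).congr_deriv ?_
  simp only [inner_zero_right, zero_add, real_inner_smul_left]
  module

lemma hasDerivAt_normalize {q : ℝ → E} {v : E} {t : ℝ} (hq : HasDerivAt q v t) (h0 : q t ≠ 0) :
    HasDerivAt (fun s => NormedSpace.normalize (q s))
      ((‖q t‖ ^ 3)⁻¹ • angularMomentum (q t) v (q t)) t := by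
  refine ((hasDerivAt_norm_inv hq h0).fun_smul hq).congr_deriv ?_
  have hn : ‖q t‖ ≠ 0 := norm_ne_zero_iff.2 h0
  rw [angularMomentum, real_inner_self_eq_norm_sq, real_inner_comm]
  match_scalars <;> field_simp

end AngularMomentum

section KeplerMotion

variable {E : Type*} [NormedAddCommGroup E] [InnerProductSpace ℝ E]

/-- The energy of a unit mass point in the Kepler potential `-k / ‖q‖` of an arbitrary inner
product space; for `R4` this is `hamiltonian`. -/
noncomputable def energy (k : ℝ) (q p : E) : ℝ := ‖p‖ ^ 2 / 2 - k / ‖q‖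

lemma hasGradientAt_energy_momentum [CompleteSpace E] (k : ℝ) (q p : E) :
    HasGradientAt (fun v => energy k q v) p p := by
  rw [hasGradientAt_iff_hasFDerivAt]
  have h := ((hasStrictFDerivAt_norm_sq p).hasFDerivAt.mul_const (2⁻¹ : ℝ)).sub_const (k / ‖q‖)
  simp only [← div_eq_mul_inv] at h
  refine h.congr_fderiv ?_
  ext w
  simp

lemma hasGradientAt_energy_position [CompleteSpace E] (k : ℝ) {q : E} (hq : q ≠ 0) (p : E) :
    HasGradientAt (fun u => energy k u p) ((k / ‖q‖ ^ 3) • q) q := by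
  have hn : ‖q‖ ≠ 0 := norm_ne_zero_iff.2 hq
  rw [hasGradientAt_iff_hasFDerivAt]
  have h := (((hasDerivAt_inv hn).comp_hasFDerivAt q (hasFDerivAt_norm hq)).const_mul
    k).const_sub (‖p‖ ^ 2 / 2)
  simp only [Function.comp_def, ← div_eq_mul_inv] at h
  refine h.congr_fderiv ?_
  rw [map_smul, smul_smul, smul_smul, ← neg_smul]
  congr 1
  field_simp

/-- `q` is a motion, with velocity `p`, of a unit mass point in the Kepler field of strength `k`
of an arbitrary inner product space during the open time interval `I`. The force is written as in
Newton's equation, since gradients exist only in complete spaces. -/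
structure IsKeplerMotion (k : ℝ) (I : Set ℝ) (q p : ℝ → E) : Prop where
  isOpen : IsOpen I
  isPreconnected : IsPreconnected I
  ne_zero : ∀ t ∈ I, q t ≠ 0
  hasDerivAt_position : ∀ t ∈ I, HasDerivAt q (p t) t
  hasDerivAt_momentum : ∀ t ∈ I, HasDerivAt p ((-(k / ‖q t‖ ^ 3)) • q t) t

namespace IsKeplerMotion

variable {k : ℝ} {I : Set ℝ} {q p : ℝ → E} {l : Filter ℝ} {s t : ℝ}

lemma energy_eq (h : IsKeplerMotion k I q p) (hs : s ∈ I) (ht : t ∈ I) :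
    energy k (q s) (p s) = energy k (q t) (p t) := by
  refine eq_of_hasDerivAt_zero h.isOpen h.isPreconnected
    (f := fun t => energy k (q t) (p t)) (fun t ht => ?_) hs ht
  have hkinetic := (h.hasDerivAt_momentum t ht).norm_sq.div_const 2
  have hpotential :=
    (hasDerivAt_norm_inv (h.hasDerivAt_position t ht) (h.ne_zero t ht)).const_mul k
  refine (hkinetic.fun_sub hpotential).congr_deriv ?_
  rw [real_inner_smul_right, real_inner_comm]
  ring

lemma angularMomentum_eq (h : IsKeplerMotion k I q p) (u : E) (hs : s ∈ I) (ht : t ∈ I) :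
    angularMomentum (q s) (p s) u = angularMomentum (q t) (p t) u :=
  eq_of_hasDerivAt_zero h.isOpen h.isPreconnected
    (f := fun t => angularMomentum (q t) (p t) u)
    (fun t ht => hasDerivAt_angularMomentum_of_central_force
      (h.hasDerivAt_position t ht) (h.hasDerivAt_momentum t ht) u) hs ht

lemma tendsto_norm_mul_norm_zero (h : IsKeplerMotion k I q p) [l.NeBot] (hl : I ∈ l)
    (hq : Tendsto q l (𝓝 0)) :
    Tendsto (fun t => ‖q t‖ * ‖p t‖) l (𝓝 0) := by
  obtain ⟨s, hs⟩ := nonempty_of_mem hl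
  set c := energy k (q s) (p s)
  have hlim : Tendsto (fun t => √(2 * c * ‖q t‖ ^ 2 + 2 * k * ‖q t‖)) l (𝓝 0) := by
    simpa using (((hq.norm.pow 2).const_mul (2 * c)).add (hq.norm.const_mul (2 * k))).sqrt
  refine hlim.congr' ?_
  filter_upwards [hl] with t ht
  have hn : ‖q t‖ ≠ 0 := norm_ne_zero_iff.2 (h.ne_zero t ht)
  have hc : c = ‖p t‖ ^ 2 / 2 - k / ‖q t‖ := h.energy_eq hs ht
  have hsq : 2 * c * ‖q t‖ ^ 2 + 2 * k * ‖q t‖ = (‖q t‖ * ‖p t‖) ^ 2 := by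
    rw [hc]
    field_simp
    ring
  rw [hsq, Real.sqrt_sq (by positivity)]

lemma angularMomentum_eq_zero (h : IsKeplerMotion k I q p) [l.NeBot] (hl : I ∈ l)
    (hq : Tendsto q l (𝓝 0)) (u : E) (ht : t ∈ I) : angularMomentum (q t) (p t) u = 0 := by
  have hlim : Tendsto (fun s => angularMomentum (q s) (p s) u) l (𝓝 0) :=
    squeeze_zero_norm (fun s => norm_angularMomentum_le _ _ _) <| by
      simpa using (h.tendsto_norm_mul_norm_zero hl hq).const_mul (2 * ‖u‖)
  refine tendsto_nhds_unique (tendsto_const_nhds.congr' ?_) hlim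
  filter_upwards [hl] with s hs using h.angularMomentum_eq u ht hs

lemma exists_eq_norm_smul (h : IsKeplerMotion k I q p) [l.NeBot] (hl : I ∈ l)
    (hq : Tendsto q l (𝓝 0)) : ∃ e : E, ‖e‖ = 1 ∧ ∀ t ∈ I, q t = ‖q t‖ • e := by
  obtain ⟨s, hs⟩ := nonempty_of_mem hl
  refine ⟨NormedSpace.normalize (q s),
    NormedSpace.norm_normalize_eq_one_iff.2 (h.ne_zero s hs), fun t ht => ?_⟩
  have hconst : NormedSpace.normalize (q s) = NormedSpace.normalize (q t) :=
    eq_of_hasDerivAt_zero h.isOpen h.isPreconnected (fun t ht => by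
      simpa [h.angularMomentum_eq_zero hl hq (q t) ht] using
        hasDerivAt_normalize (h.hasDerivAt_position t ht) (h.ne_zero t ht)) hs ht
  rw [hconst, NormedSpace.norm_smul_normalize]

lemma hasDerivAt_inner_normalize_momentum (h : IsKeplerMotion k I q p) (ht : t ∈ I) :
    HasDerivAt (fun s => ⟪NormedSpace.normalize (q s), p s⟫)
      (⟪angularMomentum (q t) (p t) (q t), p t⟫ / ‖q t‖ ^ 3 - k / ‖q t‖ ^ 2) t := by
  have h0 := h.ne_zero t ht
  have hn : ‖q t‖ ≠ 0 := norm_ne_zero_iff.2 h0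
  refine ((hasDerivAt_normalize (h.hasDerivAt_position t ht) h0).inner ℝ
    (h.hasDerivAt_momentum t ht)).congr_deriv ?_
  rw [NormedSpace.normalize, real_inner_smul_left, real_inner_smul_right, real_inner_smul_left,
    real_inner_self_eq_norm_sq]
  field_simp
  ring

lemma exists_radial_equation (h : IsKeplerMotion k I q p) [l.NeBot] (hl : I ∈ l)
    (hq : Tendsto q l (𝓝 0)) : ∃ P : ℝ → ℝ, ∀ t ∈ I,
      HasDerivAt (fun s => ‖q s‖) (P t) t ∧ HasDerivAt P (-k / ‖q t‖ ^ 2) t := by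
  refine ⟨fun t => ⟪NormedSpace.normalize (q t), p t⟫, fun t ht => ⟨?_, ?_⟩⟩
  · simpa [NormedSpace.normalize, real_inner_smul_left, div_eq_inv_mul] using
      hasDerivAt_norm (h.hasDerivAt_position t ht) (h.ne_zero t ht)
  · simpa [h.angularMomentum_eq_zero hl hq (q t) ht, neg_div] using
      h.hasDerivAt_inner_normalize_momentum ht

end IsKeplerMotion

end KeplerMotion

section OrthogonalSplitting

variable {E : Type*} [NormedAddCommGroup E] [InnerProductSpace ℝ E]

lemma exists_angle_starProjection (K : Submodule ℝ E) [K.HasOrthogonalProjection] {e : E}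
    (he : ‖e‖ = 1) : ∃ φ ∈ Set.Icc (0 : ℝ) (Real.pi / 2),
      ‖K.starProjection e‖ = Real.cos φ ∧ ‖Kᗮ.starProjection e‖ = Real.sin φ := by
  have hle : ‖K.starProjection e‖ ≤ 1 := (K.norm_starProjection_apply_le e).trans_eq he
  refine ⟨Real.arccos ‖K.starProjection e‖,
    ⟨Real.arccos_nonneg _, Real.arccos_le_pi_div_two.2 (norm_nonneg _)⟩,
    (Real.cos_arccos (by linarith [norm_nonneg (K.starProjection e)]) hle).symm, ?_⟩
  rw [Real.sin_arccos, ← one_pow 2, ← he, K.norm_sq_eq_add_norm_sq_starProjection e,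
    add_sub_cancel_left, Real.sqrt_sq (norm_nonneg _)]

lemma exists_norm_starProjection_eq_mul (K : Submodule ℝ E) [K.HasOrthogonalProjection] {e : E}
    (heK : e ∉ K) (heK' : e ∉ Kᗮ) :
    ∃ c : ℝ, 0 < c ∧ ‖K.starProjection e‖ = c * ‖Kᗮ.starProjection e‖ := by
  have h₁ : 0 < ‖K.starProjection e‖ := by
    rwa [norm_pos_iff, ne_eq, Submodule.starProjection_apply_eq_zero_iff]
  have h₂ : 0 < ‖Kᗮ.starProjection e‖ := by
    rwa [norm_pos_iff, ne_eq, Submodule.starProjection_apply_eq_zero_iff,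
      Submodule.orthogonal_orthogonal]
  exact ⟨_, div_pos h₁ h₂, (div_mul_cancel₀ _ h₂.ne').symm⟩

end OrthogonalSplitting

section PrincipalPlanes

/-- The principal plane `Oxy`; its orthogonal complement is `Ozw`. -/
def planeOxy : Submodule ℝ R4 where
  carrier := {q | q 2 = 0 ∧ q 3 = 0}
  add_mem' := by simp +contextual
  zero_mem' := by simp
  smul_mem' := by simp +contextual

lemma starProjection_planeOxy (q : R4) : planeOxy.starProjection q = !₂[q 0, q 1, 0, 0] := by
  refine Submodule.eq_starProjection_of_mem_of_inner_eq_zero (by simp [planeOxy]) ?_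
  rintro w ⟨h2, h3⟩
  simp [PiLp.inner_apply, Fin.sum_univ_four, h2, h3]

lemma starProjection_planeOxy_orthogonal (q : R4) :
    planeOxyᗮ.starProjection q = !₂[0, 0, q 2, q 3] := by
  rw [Submodule.starProjection_orthogonal_val, starProjection_planeOxy]
  ext i
  fin_cases i <;> simp

lemma norm_starProjection_planeOxy (q : R4) : ‖planeOxy.starProjection q‖ = r₁ q := by
  rw [starProjection_planeOxy]
  simp [r₁, EuclideanSpace.norm_eq, Fin.sum_univ_four]

lemma norm_starProjection_planeOxy_orthogonal (q : R4) :
    ‖planeOxyᗮ.starProjection q‖ = r₂ q := by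
  rw [starProjection_planeOxy_orthogonal]
  simp [r₂, EuclideanSpace.norm_eq, Fin.sum_univ_four]

lemma r₁_eq_zero_iff (q : R4) : r₁ q = 0 ↔ q ∈ planeOxyᗮ := by
  rw [← norm_starProjection_planeOxy, norm_eq_zero, Submodule.starProjection_apply_eq_zero_iff]

lemma r₂_eq_zero_iff (q : R4) : r₂ q = 0 ↔ q ∈ planeOxy := by
  rw [← norm_starProjection_planeOxy_orthogonal, norm_eq_zero,
    Submodule.starProjection_apply_eq_zero_iff, Submodule.orthogonal_orthogonal]

lemma norm_sq_eq_r₁_sq_add_r₂_sq (q : R4) : ‖q‖ ^ 2 = r₁ q ^ 2 + r₂ q ^ 2 := by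
  rw [← norm_starProjection_planeOxy, ← norm_starProjection_planeOxy_orthogonal,
    ← Submodule.norm_sq_eq_add_norm_sq_starProjection]

end PrincipalPlanes

section TimeInterval

variable {k : ℝ} {a b : EReal} {q p : ℝ → R4}

lemma isOpen_timeInterval (a b : EReal) : IsOpen (timeInterval a b) :=
  (isOpen_Ioo (a := a) (b := b)).preimage continuous_coe_real_ereal

lemma isPreconnected_timeInterval (a b : EReal) : IsPreconnected (timeInterval a b) :=
  ((Set.ordConnected_Ioo (a := a) (b := b)).preimage_mono
    EReal.coe_strictMono.monotone).isPreconnected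

lemma neBot_comap_coe_nhdsLT (h : a < b) : (comap Real.toEReal (𝓝[<] b)).NeBot :=
  (nhdsLT_neBot_of_exists_lt ⟨a, h⟩).comap_of_range_mem <| by
    rw [EReal.range_coe_eq_Ioo]
    exact mem_of_superset (Ioo_mem_nhdsLT h) (Set.Ioo_subset_Ioo bot_le le_top)

lemma neBot_comap_coe_nhdsGT (h : a < b) : (comap Real.toEReal (𝓝[>] a)).NeBot :=
  (nhdsGT_neBot_of_exists_gt ⟨b, h⟩).comap_of_range_mem <| by
    rw [EReal.range_coe_eq_Ioo]
    exact mem_of_superset (Ioo_mem_nhdsGT h) (Set.Ioo_subset_Ioo bot_le le_top)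

lemma IsCollisional.exists_neBot_tendsto_zero (hcoll : IsCollisional a b q) (hab : a < b) :
    ∃ l : Filter ℝ, l.NeBot ∧ timeInterval a b ∈ l ∧ Tendsto q l (𝓝 0) := by
  have tendsto_q {l : Filter ℝ} (hl : Tendsto (fun t => r₁ (q t) ^ 2 + r₂ (q t) ^ 2) l (𝓝 0)) :
      Tendsto q l (𝓝 0) := by
    rw [tendsto_zero_iff_norm_tendsto_zero]
    simpa [← norm_sq_eq_r₁_sq_add_r₂_sq, Real.sqrt_sq] using hl.sqrt
  rcases hcoll with h | h
  · exact ⟨_, neBot_comap_coe_nhdsLT hab, preimage_mem_comap (Ioo_mem_nhdsLT hab), tendsto_q h⟩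
  · exact ⟨_, neBot_comap_coe_nhdsGT hab, preimage_mem_comap (Ioo_mem_nhdsGT hab), tendsto_q h⟩

lemma IsMotion.isKeplerMotion (h : IsMotion k a b q p) :
    IsKeplerMotion k (timeInterval a b) q p where
  isOpen := isOpen_timeInterval a b
  isPreconnected := isPreconnected_timeInterval a b
  ne_zero := h.ne_zero
  hasDerivAt_position t ht :=
    (hasGradientAt_energy_momentum k (q t) (p t)).gradient ▸ h.deriv_q t ht
  hasDerivAt_momentum t ht := by
    rw [neg_smul, ← (hasGradientAt_energy_position k (h.ne_zero t ht) (p t)).gradient]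
    exact h.deriv_p t ht

end TimeInterval

end Kepler4

open Kepler4 in
/-- The subspaces `K` and `Kᗮ` play the part of the principal planes, the norms of the orthogonal
projections that of the polar radii, and `l` that of the times tending to the collision. -/
theorem mainTheorem6_general {E : Type*} [NormedAddCommGroup E] [InnerProductSpace ℝ E]
    (K : Submodule ℝ E) [K.HasOrthogonalProjection] {k : ℝ} {I : Set ℝ} {q p : ℝ → E}
    (h : IsKeplerMotion k I q p) {l : Filter ℝ} [l.NeBot] (hl : I ∈ l)
    (hq : Tendsto q l (𝓝 0)) :
    (¬ ((∀ t ∈ I, q t ∈ Kᗮ) ∨ ∀ t ∈ I, q t ∈ K) → ∃ c : ℝ, 0 < c ∧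
      ∀ t ∈ I, ‖K.starProjection (q t)‖ = c * ‖Kᗮ.starProjection (q t)‖) ∧
    (∃ φ ∈ Set.Icc (0 : ℝ) (Real.pi / 2), ∀ t ∈ I,
      ‖K.starProjection (q t)‖ = ‖q t‖ * Real.cos φ ∧
      ‖Kᗮ.starProjection (q t)‖ = ‖q t‖ * Real.sin φ) ∧
    Collinear ℝ (insert 0 (q '' I)) ∧
    (∃ e : E, ‖e‖ = 1 ∧ ∀ t ∈ I, q t = ‖q t‖ • e) ∧
    (∃ P : ℝ → ℝ, ∀ t ∈ I,
      HasDerivAt (fun s => ‖q s‖) (P t) t ∧ HasDerivAt P (-k / ‖q t‖ ^ 2) t) := by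
  obtain ⟨e, he, hqe⟩ := h.exists_eq_norm_smul hl hq
  have hproj (L : Submodule ℝ E) [L.HasOrthogonalProjection] :
      ∀ t ∈ I, ‖L.starProjection (q t)‖ = ‖q t‖ * ‖L.starProjection e‖ := fun t ht => by
    conv_lhs => rw [hqe t ht, map_smul, norm_smul, norm_norm]
  have hmem {L : Submodule ℝ E} (heL : e ∈ L) : ∀ t ∈ I, q t ∈ L := fun t ht =>
    hqe t ht ▸ L.smul_mem _ heL
  refine ⟨fun hplane => ?_, ?_, ?_, ⟨e, he, hqe⟩, h.exists_radial_equation hl hq⟩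
  · obtain ⟨c, hc, hratio⟩ := exists_norm_starProjection_eq_mul K
      (fun heK => hplane (.inr (hmem heK))) (fun heK => hplane (.inl (hmem heK)))
    exact ⟨c, hc, fun t ht => by rw [hproj K t ht, hproj Kᗮ t ht, hratio, mul_left_comm]⟩
  · obtain ⟨φ, hφ, hcos, hsin⟩ := exists_angle_starProjection K he
    exact ⟨φ, hφ, fun t ht => ⟨hcos ▸ hproj K t ht, hsin ▸ hproj Kᗮ t ht⟩⟩
  · rw [collinear_iff_of_mem (Set.mem_insert 0 _)]
    refine ⟨e, Set.forall_mem_insert.2 ⟨⟨0, by simp⟩, Set.forall_mem_image.2 fun t ht => ?_⟩⟩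
    exact ⟨‖q t‖, by simpa using hqe t ht⟩

theorem mainTheorem6 (k : ℝ) (hk : 0 < k) (a b : EReal) (q p : ℝ → Kepler4.R4)
    (hmotion : Kepler4.IsMotion k a b q p) (hcoll : Kepler4.IsCollisional a b q) :
    -- the ratio of the polar radii is a positive constant, unless one of the radii vanishes
    (¬ Kepler4.InPrincipalPlane a b q → Kepler4.IsProportional a b q) ∧
    -- in every case the angle `φ` with `r₁ = R cos φ`, `r₂ = R sin φ` is constant
    (∃ φ ∈ Set.Icc (0 : ℝ) (Real.pi / 2), ∀ t ∈ Kepler4.timeInterval a b,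
      Kepler4.r₁ (q t) = ‖q t‖ * Real.cos φ ∧ Kepler4.r₂ (q t) = ‖q t‖ * Real.sin φ) ∧
    -- the orbit lies on a line through the source
    Collinear ℝ (insert 0 (q '' Kepler4.timeInterval a b)) ∧
    -- it is `R(t)` times a constant unit vector, and `R` solves the radial Kepler equation
    (∃ e : Kepler4.R4, ‖e‖ = 1 ∧ ∀ t ∈ Kepler4.timeInterval a b, q t = ‖q t‖ • e) ∧
    (∃ P : ℝ → ℝ, ∀ t ∈ Kepler4.timeInterval a b,
      HasDerivAt (fun s => ‖q s‖) (P t) t ∧ HasDerivAt P (-k / ‖q t‖ ^ 2) t) := by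
  obtain ⟨l, _, hl, hq⟩ := hcoll.exists_neBot_tendsto_zero hmotion.lt
  simpa only [Kepler4.InPrincipalPlane, Kepler4.IsProportional,
    Kepler4.norm_starProjection_planeOxy, Kepler4.norm_starProjection_planeOxy_orthogonal,
    ← Kepler4.r₁_eq_zero_iff, ← Kepler4.r₂_eq_zero_iff] using
    mainTheorem6_general Kepler4.planeOxy hmotion.isKeplerMotion hl hq
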